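/- Let $\mathbb{D}=\{z\in\mathbb{C}:|z|<1\}$. For analytic functions $f,g$ on $\mathbb{D}$ write $f\prec g$ ($f$ is subordinate to $g$) if there is an analytic $w:\mathbb{D}\to\mathbb{D}$ with $w(0)=0$ and $f(z)=g(w(z))$ for all $z\in\mathbb{D}$. Put $$\varphi_{Ne}(z)=1+z-\frac{z^3}{3},\qquad \varphi_S(z)=1+\sin z,\qquad \varphi_0(z)=1+\frac{z}{k}\cdot\frac{k+z}{k-z}\quad (k=1+\sqrt2).$$ For $\beta\in\mathbb{R}$ consider the analytic functions $p$ on $\mathbb{D}$ with $p(0)=1$ and $$1+\beta\,\frac{zp'(z)}{p(z)}\prec\varphi_{Ne}(z).\qquad(*)$$ (For $\beta\neq0$ such a $p$ necessarily has no zeros in $\mathbb{D}$.) Then: (a) if $\beta\ge \dfrac{8/9}{\log(1+\sin 1)}$, every such $p$ satisfies $p\prec\varphi_S$; (b) if $\beta\ge -\dfrac{8/9}{\log(2\sqrt2-2)}$, every such $p$ satisfies $p\prec\varphi_0$; (c) if $\beta\ge \dfrac{8/9}{\log(5/3)}$, every such $p$ satisfies $p\prec\varphi_{Ne}$. The three bounds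 are best possible: if $b$ denotes the bound in (a), (b) or (c), then for every $0<\beta<b$ there is a zero-free analytic function $p$ on $\mathbb{D}$ with $p(0)=1$ that satisfies $(*)$ but not the conclusion of that part. -/

import Mathlib

/-- The open unit disk `𝔻`. -/
def unitDisk : Set ℂ := Metric.ball (0 : ℂ) 1

/-- `f ≺ g` on the unit disk: `f = g ∘ w` for some holomorphic `w : 𝔻 → 𝔻` with `w 0 = 0`. -/
def Subordinate (f g : ℂ → ℂ) : Prop :=
  ∃ w : ℂ → ℂ, DifferentiableOn ℂ w unitDisk ∧ w 0 = 0 ∧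
    (∀ z ∈ unitDisk, ‖w z‖ < 1) ∧ ∀ z ∈ unitDisk, f z = g (w z)

/-- The nephroid function `φ_Ne(z) = 1 + z - z³/3`. -/
noncomputable def phiNe (z : ℂ) : ℂ := 1 + z - z ^ 3 / 3

/-- The sine function `φ_S(z) = 1 + sin z`. -/
noncomputable def phiS (z : ℂ) : ℂ := 1 + Complex.sin z

/-- The rational function `φ₀(z) = 1 + (z/k) (k + z)/(k - z)` with `k = 1 + √2`
(holomorphic on the unit disk, its pole being at `k > 1`). -/
noncomputable def phi0 (z : ℂ) : ℂ :=
  let k : ℂ := ((1 + Real.sqrt 2 : ℝ) : ℂ)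
  1 + z / k * ((k + z) / (k - z))

/-- `p` is holomorphic on `𝔻`, `p 0 = 1`, and `1 + β z p'(z) / p(z) ≺ φ_Ne(z)`.
For `β ≠ 0` such a `p` has no zero in `𝔻`: the right-hand side is bounded and holomorphic, whereas
`p'/p` is unbounded near a zero of `p`. So the value that division by zero gets plays no role. -/
def IsNephroidSolution (β : ℝ) (p : ℂ → ℂ) : Prop :=
  DifferentiableOn ℂ p unitDisk ∧ p 0 = 1 ∧
    Subordinate (fun z => 1 + (β : ℂ) * (z * deriv p z / p z)) phiNe

/-- `b` is a sharp bound on `β` for the conclusion `p ≺ φ`: the conclusion holds for all solutions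
whenever `β ≥ b`, and for each `0 < β < b` it fails for some (zero-free) solution. -/
def IsSharpNephroidBound (φ : ℂ → ℂ) (b : ℝ) : Prop :=
  (∀ β : ℝ, b ≤ β → ∀ p : ℂ → ℂ, IsNephroidSolution β p → Subordinate p φ) ∧
  (∀ β : ℝ, 0 < β → β < b →
    ∃ p : ℂ → ℂ, IsNephroidSolution β p ∧ (∀ z ∈ unitDisk, p z ≠ 0) ∧ ¬ Subordinate p φ)

/-! Let Q(z) = z - z³/9, so that zQ' = φ_Ne - 1. A solution is p = exp L with zL' = (φ_Ne∘w - 1)/β,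
and the extremal one is exp(Q/β). Each bound has the form b = (8/9)/log E.

Put c = (9/8) log E. For β ≥ b, L/c takes values in Q(𝔻) (`mem_image_nephroidPrimitive`): at a first
escape point Jack's lemma gives z(L/c)' = mζQ'(ζ) with |ζ| = 1, m ≥ 1, which starlikeness of φ_Ne(𝔻)
- 1 forbids. So p(𝔻) ⊆ exp(cQ(𝔻)). This connected set contains 1 = φ(0), so it lies in φ(𝔻) once it
misses φ of the unit circle. The estimates |Re Q| < 8/9 and |Q| ≤ 10/9 give the inequalities
`NephroidExpBounds` on exp(cQ(𝔻)), and for each φ every boundary value violates one of them.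

Sharpness: for β < b the extremal function reaches real values ≥ E and ≤ 1/E on the real diameter,
and φ(𝔻) contains none on one of these two sides. -/

open Metric Set Filter Topology

/-! ### Univalent maps and their images -/

/-- A holomorphic injection with non-vanishing derivative has a holomorphic left inverse. -/
theorem exists_differentiableAt_leftInverse {φ : ℂ → ℂ} {S : Set ℂ} (hS : IsOpen S)
    (hφ : DifferentiableOn ℂ φ S) (hinj : InjOn φ S) (hd : ∀ z ∈ S, deriv φ z ≠ 0) :
    ∃ g : ℂ → ℂ, ∀ a ∈ S, g (φ a) = a ∧ DifferentiableAt ℂ g (φ a) := by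
  refine ⟨Function.invFunOn φ S, fun a ha => ⟨hinj.leftInvOn_invFunOn ha, ?_⟩⟩
  have hs : HasStrictDerivAt φ (deriv φ a) a :=
    (hφ.analyticAt (hS.mem_nhds ha)).hasStrictDerivAt
  refine (hs.to_local_left_inverse (hd a ha) ?_).hasDerivAt.differentiableAt
  filter_upwards [hS.mem_nhds ha] with x hx using hinj.leftInvOn_invFunOn hx

/-- A holomorphic function with non-vanishing derivative on an open set has open image. -/
theorem isOpen_image_of_deriv_ne_zero {φ : ℂ → ℂ} {S : Set ℂ} (hS : IsOpen S)
    (hφ : DifferentiableOn ℂ φ S) (hd : ∀ z ∈ S, deriv φ z ≠ 0) : IsOpen (φ '' S) := by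
  rw [isOpen_iff_mem_nhds]
  rintro _ ⟨a, ha, rfl⟩
  have hs : HasStrictDerivAt φ (deriv φ a) a :=
    (hφ.analyticAt (hS.mem_nhds ha)).hasStrictDerivAt
  rw [← hs.map_nhds_eq (hd a ha)]
  exact image_mem_map (hS.mem_nhds ha)

theorem closure_image_ball_subset {φ : ℂ → ℂ} {c : ℂ} {r : ℝ}
    (hc : ContinuousOn φ (closedBall c r)) :
    closure (φ '' ball c r) ⊆ φ '' closedBall c r :=
  closure_minimal (image_mono ball_subset_closedBall)
    ((isCompact_closedBall c r).image_of_continuousOn hc).isClosed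

/-- A connected set that meets `φ '' ball c r` and avoids `φ '' sphere c r` lies in
`φ '' ball c r`. -/
theorem IsPreconnected.subset_image_ball {φ : ℂ → ℂ} {c : ℂ} {r : ℝ} {V : Set ℂ}
    (hV : IsPreconnected V) (ho : IsOpen (φ '' ball c r))
    (hc : ContinuousOn φ (closedBall c r)) (hne : (V ∩ φ '' ball c r).Nonempty)
    (hdisj : ∀ ζ ∈ sphere c r, φ ζ ∉ V) : V ⊆ φ '' ball c r := by
  refine hV.subset_of_closure_inter_subset ho hne ?_
  rintro y ⟨hy, hyV⟩
  obtain ⟨ζ, hζ, rfl⟩ := closure_image_ball_subset hc hy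
  rcases (mem_closedBall.1 hζ).lt_or_eq with h | h
  · exact ⟨ζ, h, rfl⟩
  · exact absurd hyV (hdisj ζ h)

/-! ### Jack's lemma -/

/-- **Jack's lemma**: if a holomorphic self-map fixing `0` attains modulus `1` at a boundary
point `z₀`, then `z₀ v'(z₀) = m v(z₀)` with `m ≥ 1`. -/
theorem jack_lemma {v : ℂ → ℂ} {r : ℝ} {z₀ : ℂ} (hr : 0 < r) (hz₀ : ‖z₀‖ = r)
    (hv : DifferentiableOn ℂ v (ball 0 r)) (hv0 : v 0 = 0)
    (hb : ∀ z ∈ ball (0 : ℂ) r, ‖v z‖ < 1)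
    {v' : ℂ} (hd : HasDerivAt v v' z₀) (h1 : ‖v z₀‖ = 1) :
    ∃ m : ℝ, 1 ≤ m ∧ z₀ * v' = m * v z₀ := by
  set A : ℂ := (starRingEnd ℂ) (v z₀) * (z₀ * v') with hA
  have hunit : (starRingEnd ℂ) (v z₀) * v z₀ = 1 := by
    rw [mul_comm, Complex.mul_conj, Complex.normSq_eq_norm_sq, h1]; norm_num
  have hsch : ∀ z ∈ ball (0 : ℂ) r, ‖v z‖ ≤ ‖z‖ / r := by
    intro z hz
    have hm : MapsTo v (ball 0 r) (closedBall (v 0) 1) := by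
      intro y hy
      rw [hv0, mem_closedBall_zero_iff]
      exact (hb y hy).le
    have := Complex.dist_le_div_mul_dist_of_mapsTo_ball hv hm hz
    rw [hv0, dist_zero_right, dist_zero_right] at this
    rw [div_eq_mul_one_div, mul_comm]; exact this
  -- Move inward from z₀ to z₀(1 + εd). The Schwarz bound `hsch` limits Re(conj(v(z₀)) v) by |1 +
  -- εd|; comparing first-order terms in ε gives the claim.
  have key : ∀ d : ℂ, d.re < 0 → (A * d).re ≤ d.re := by
    intro d hd0
    have hline : HasDerivAt (fun ε : ℝ => z₀ * (1 + (ε : ℂ) * d)) (z₀ * d) 0 := by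
      have h1 : HasDerivAt (fun ε : ℝ => (ε : ℂ)) 1 0 := Complex.ofRealCLM.hasDerivAt
      have := ((h1.mul_const d).const_add 1).const_mul z₀
      simpa using this
    have hcomp : HasDerivAt (fun ε : ℝ => v (z₀ * (1 + (ε : ℂ) * d))) (v' * (z₀ * d)) 0 := by
      refine HasDerivAt.comp (0 : ℝ) (h₂ := v) ?_ hline
      simpa using hd
    -- This function vanishes at 0 and is nonpositive for small ε > 0, because |1 + εd| ≤ (1 + |1 +
    -- εd|²)/2 = 1 + ε Re d + ε²|d|²/2.
    have hre : HasDerivAt (fun ε : ℝ => ((starRingEnd ℂ) (v z₀) *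
        v (z₀ * (1 + (ε : ℂ) * d))).re - 1 - ε * d.re - ε ^ 2 * ‖d‖ ^ 2 / 2)
        ((A * d).re - d.re) 0 := by
      have e1 := (hcomp.const_mul ((starRingEnd ℂ) (v z₀)))
      have e2 : HasDerivAt (fun ε : ℝ => ((starRingEnd ℂ) (v z₀) *
        v (z₀ * (1 + (ε : ℂ) * d))).re) ((A * d).re) 0 := by
        have := Complex.reCLM.hasFDerivAt.comp_hasDerivAt (0 : ℝ) e1
        refine this.congr_deriv ?_
        change ((starRingEnd ℂ) (v z₀) * (v' * (z₀ * d))).re = _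
        rw [hA]; congr 1; ring
      have e3 : HasDerivAt (fun ε : ℝ => ε * d.re) d.re 0 := by
        simpa using (hasDerivAt_id (0 : ℝ)).mul_const d.re
      have e4 : HasDerivAt (fun ε : ℝ => ε ^ 2 * ‖d‖ ^ 2 / 2) 0 0 := by
        simpa using ((hasDerivAt_pow 2 (0 : ℝ)).mul_const (‖d‖ ^ 2)).div_const 2
      exact (((e2.sub_const 1).sub e3).sub e4).congr_deriv (sub_zero _)
    have hle : (A * d).re - d.re ≤ 0 := by
      have hslope := (hasDerivAt_iff_tendsto_slope_zero.1 hre).mono_left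
        (nhdsWithin_mono (0 : ℝ) (fun x (hx : x ∈ Ioi (0 : ℝ)) => (ne_of_gt hx : x ≠ 0)))
      have hd2 : 0 < ‖d‖ ^ 2 := by
        have : d ≠ 0 := by rintro rfl; simp at hd0
        positivity
      have hpos : 0 < -d.re / ‖d‖ ^ 2 := by
        have : 0 < -d.re := by linarith
        positivity
      refine le_of_tendsto hslope ?_
      filter_upwards [Ioo_mem_nhdsGT hpos] with ε hε
      have hsq : ‖1 + (ε : ℂ) * d‖ ^ 2 = 1 + 2 * ε * d.re + ε ^ 2 * ‖d‖ ^ 2 := by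
        rw [← Complex.normSq_eq_norm_sq, ← Complex.normSq_eq_norm_sq, Complex.normSq_apply,
          Complex.normSq_apply]
        simp; ring
      have hlt : ‖1 + (ε : ℂ) * d‖ < 1 := by
        have h2 : ε * ‖d‖ ^ 2 < -d.re := by
          have := hε.2; rwa [lt_div_iff₀ hd2] at this
        have : ‖1 + (ε : ℂ) * d‖ ^ 2 < 1 := by
          rw [hsq]; nlinarith [hε.1, mul_pos hε.1 (sub_pos.2 h2), mul_pos hε.1 (neg_pos.2 hd0)]
        nlinarith [norm_nonneg (1 + (ε : ℂ) * d)]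
      have hmem : z₀ * (1 + (ε : ℂ) * d) ∈ ball (0 : ℂ) r := by
        rw [mem_ball_zero_iff, norm_mul, hz₀]; nlinarith
      have hvle : ((starRingEnd ℂ) (v z₀) * v (z₀ * (1 + (ε : ℂ) * d))).re
          ≤ ‖1 + (ε : ℂ) * d‖ := by
        refine (Complex.re_le_norm _).trans ?_
        rw [norm_mul, RCLike.norm_conj, h1, one_mul]
        refine (hsch _ hmem).trans_eq ?_
        rw [norm_mul, hz₀]; field_simp
      simp only [zero_add, Complex.ofReal_zero, zero_mul, add_zero, mul_one, hunit, smul_eq_mul]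
      refine mul_nonpos_of_nonneg_of_nonpos (inv_nonneg.2 hε.1.le) ?_
      simp only [Complex.one_re]
      nlinarith [sq_nonneg (‖1 + (ε : ℂ) * d‖ - 1)]
    linarith
  have hre1 : 1 ≤ A.re := by
    have := key (-1) (by simp)
    simp at this; linarith
  have him : A.im = 0 := by
    by_contra hne
    -- Nearly tangential directions -ε ± i isolate Im A; this ε makes the error ε Re A only half of
    -- |Im A|.
    set ε := |A.im| / (2 * A.re) with hε
    have hεpos : 0 < ε := by have := abs_pos.2 hne; positivity
    have hεA : ε * A.re = |A.im| / 2 := by rw [hε]; field_simp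
    have hab := abs_pos.2 hne
    rcases abs_cases A.im with ⟨h, _⟩ | ⟨h, _⟩
    · have := key ⟨-ε, -1⟩ (by simpa using hεpos)
      simp at this; nlinarith
    · have := key ⟨-ε, 1⟩ (by simpa using hεpos)
      simp at this; nlinarith
  refine ⟨A.re, hre1, ?_⟩
  have hAre : ((A.re : ℝ) : ℂ) = A := by apply Complex.ext <;> simp [him]
  rw [hAre, hA]
  linear_combination (-(z₀ * v')) * hunit

/-! ### The nephroid primitive and the subordination of logarithms -/

/-- The primitive `z - z³/9` of `(φ_Ne(z) - 1)/z`. -/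
noncomputable def nephroidPrimitive (z : ℂ) : ℂ := z - z ^ 3 / 9

theorem hasDerivAt_nephroidPrimitive (z : ℂ) :
    HasDerivAt nephroidPrimitive (1 - z ^ 2 / 3) z := by
  have := (hasDerivAt_id z).sub ((hasDerivAt_pow 3 z).div_const 9)
  refine this.congr_deriv ?_
  norm_num; ring

theorem differentiable_nephroidPrimitive : Differentiable ℂ nephroidPrimitive :=
  fun z => (hasDerivAt_nephroidPrimitive z).differentiableAt

theorem one_sub_ne_zero_of_norm_lt {u : ℂ} {c : ℝ} (hc : 0 < c) (h : ‖u‖ < c) :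
    1 - u / c ≠ 0 := by
  intro h0
  have h1 : u = c := by
    have hc' : (c : ℂ) ≠ 0 := by exact_mod_cast hc.ne'
    field_simp at h0
    linear_combination -h0
  rw [h1, Complex.norm_real, Real.norm_of_nonneg hc.le] at h
  exact lt_irrefl _ h

theorem norm_sq_add_mul_add_sq_lt {a b : ℂ} {r : ℝ} (ha : ‖a‖ < r) (hb : ‖b‖ ≤ r) :
    ‖a ^ 2 + a * b + b ^ 2‖ < 3 * r ^ 2 := by
  have h := norm_add₃_le (a := a ^ 2) (b := a * b) (c := b ^ 2)
  rw [norm_pow, norm_mul, norm_pow] at h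
  have := norm_nonneg a
  have := norm_nonneg b
  nlinarith

/-- The divided difference 1 - (a² + ab + b²)/9 cannot vanish, since 3·(3/2)² < 9. A radius above 1
makes the inverse holomorphic also at images of the unit circle; being below √3, it avoids the
critical points. -/
theorem injOn_nephroidPrimitive : InjOn nephroidPrimitive (ball 0 (3 / 2)) := by
  intro a ha b hb hab
  rw [mem_ball_zero_iff] at ha hb
  have h := one_sub_ne_zero_of_norm_lt (c := 9) (by norm_num)
    ((norm_sq_add_mul_add_sq_lt ha hb.le).trans (by norm_num))
  have h2 : (a - b) * (1 - (a ^ 2 + a * b + b ^ 2) / (9 : ℝ)) = 0 := by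
    unfold nephroidPrimitive at hab
    push_cast
    linear_combination hab
  exact sub_eq_zero.1 ((mul_eq_zero.1 h2).resolve_right h)

/-- The region `φ_Ne(𝔻) - 1` is starlike, and stays away from the outward dilates of its
boundary. -/
theorem nephroid_ne_mul_of_one_le {a b : ℂ} (ha : ‖a‖ < 1) (hb : ‖b‖ = 1) {m : ℝ} (hm : 1 ≤ m) :
    a - a ^ 3 / 3 ≠ m * (b - b ^ 3 / 3) := by
  intro h
  obtain ⟨x, y⟩ := a
  obtain ⟨s, t⟩ := b
  have ha2 : x ^ 2 + y ^ 2 < 1 := by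
    have : ‖(⟨x, y⟩ : ℂ)‖ ^ 2 < 1 := by nlinarith [norm_nonneg (⟨x, y⟩ : ℂ)]
    rw [← Complex.normSq_eq_norm_sq, Complex.normSq_mk] at this; linarith
  have hb2 : s ^ 2 + t ^ 2 = 1 := by
    have : ‖(⟨s, t⟩ : ℂ)‖ ^ 2 = 1 := by rw [hb]; norm_num
    rw [← Complex.normSq_eq_norm_sq, Complex.normSq_mk] at this; linarith
  have hre : x - (x ^ 3 - 3 * x * y ^ 2) / 3 = m * (s - (s ^ 3 - 3 * s * t ^ 2) / 3) := by
    have := congrArg Complex.re h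
    simp [pow_succ] at this
    linarith
  have him : y - (3 * x ^ 2 * y - y ^ 3) / 3 = m * (t - (3 * s ^ 2 * t - t ^ 3) / 3) := by
    have := congrArg Complex.im h
    simp [pow_succ] at this
    linarith
  -- Compare squared moduli: |u - u³/3|² = 4/9 + (4/3)|u|²(Im u)² - (1 - |u|²)²(4 - |u|²)/9, whose
  -- last term vanishes on the circle. This forces m²t² < y², whereas the imaginary parts (`hR`)
  -- force the reverse.
  have hN : (4 / 3) * (x ^ 2 + y ^ 2) * y ^ 2
      - (1 - (x ^ 2 + y ^ 2)) ^ 2 * (4 - (x ^ 2 + y ^ 2)) / 9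
      = (m ^ 2 - 1) * (4 / 9) + m ^ 2 * ((4 / 3) * t ^ 2) := by
    have e1 : (x - (x ^ 3 - 3 * x * y ^ 2) / 3) ^ 2 + (y - (3 * x ^ 2 * y - y ^ 3) / 3) ^ 2
        = 4 / 9 + (4 / 3) * (x ^ 2 + y ^ 2) * y ^ 2
          - (1 - (x ^ 2 + y ^ 2)) ^ 2 * (4 - (x ^ 2 + y ^ 2)) / 9 := by ring
    have e2 : (s - (s ^ 3 - 3 * s * t ^ 2) / 3) ^ 2 + (t - (3 * s ^ 2 * t - t ^ 3) / 3) ^ 2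
        = 4 / 9 + (4 / 3) * (s ^ 2 + t ^ 2) * t ^ 2
          - (1 - (s ^ 2 + t ^ 2)) ^ 2 * (4 - (s ^ 2 + t ^ 2)) / 9 := by ring
    rw [hb2] at e2
    rw [hre, him] at e1
    linear_combination -e1 + m ^ 2 * e2
  have hR : y ^ 2 * (1 - (x ^ 2 + y ^ 2) + (4 / 3) * y ^ 2) ^ 2 = (16 / 9) * (m ^ 2 * t ^ 6) := by
    have e1 : y - (3 * x ^ 2 * y - y ^ 3) / 3 = y * (1 - (x ^ 2 + y ^ 2) + (4 / 3) * y ^ 2) := by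
      ring
    have e2 : t - (3 * s ^ 2 * t - t ^ 3) / 3 = (4 / 3) * t ^ 3 := by
      linear_combination (-t) * hb2
    rw [e1, e2] at him
    rw [← mul_pow, him]; ring
  have hm2 : 1 ≤ m ^ 2 := by nlinarith
  have hlt : m ^ 2 * t ^ 2 < y ^ 2 := by
    have h1 : 0 < (1 - (x ^ 2 + y ^ 2)) ^ 2 * (4 - (x ^ 2 + y ^ 2)) :=
      mul_pos (pow_pos (by linarith) 2) (by linarith)
    have h2 : (x ^ 2 + y ^ 2) * y ^ 2 ≤ 1 * y ^ 2 := by gcongr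
    linarith
  have h3 : (m ^ 2 * t ^ 2) ^ 3 < (y ^ 2) ^ 3 := by gcongr
  have h4 : m ^ 2 * t ^ 6 ≤ (m ^ 2 * t ^ 2) ^ 3 := by
    have : m ^ 2 * t ^ 6 * 1 ≤ m ^ 2 * t ^ 6 * (m ^ 2) ^ 2 := by
      gcongr; nlinarith
    calc _ = m ^ 2 * t ^ 6 * 1 := by ring
      _ ≤ _ := this
      _ = _ := by ring
  have h5 : y ^ 2 * ((4 / 3) * y ^ 2) ^ 2
      ≤ y ^ 2 * (1 - (x ^ 2 + y ^ 2) + (4 / 3) * y ^ 2) ^ 2 := by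
    gcongr; linarith
  nlinarith

/-- If `z f'(z) = t (φ_Ne(w(z)) - 1)` with `0 ≤ t ≤ 1` and `f 0 = 0`, then `f` takes values in
`nephroidPrimitive '' 𝔻`. -/
theorem mem_image_nephroidPrimitive {f w : ℂ → ℂ} {t : ℝ} (ht : 0 ≤ t) (ht1 : t ≤ 1)
    (hf : DifferentiableOn ℂ f (ball 0 1)) (hf0 : f 0 = 0)
    (hw : ∀ z ∈ ball (0 : ℂ) 1, ‖w z‖ < 1)
    (hfw : ∀ z ∈ ball (0 : ℂ) 1, z * deriv f z = t * (w z - w z ^ 3 / 3)) :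
    ∀ z ∈ ball (0 : ℂ) 1, f z ∈ nephroidPrimitive '' ball 0 1 := by
  by_contra! hcon
  obtain ⟨z₁, hz₁, hz₁f⟩ := hcon
  have hdne : ∀ z ∈ ball (0 : ℂ) (3 / 2), deriv nephroidPrimitive z ≠ 0 := by
    intro z hz
    rw [(hasDerivAt_nephroidPrimitive z).deriv]
    rw [mem_ball_zero_iff] at hz
    have h : ‖z ^ 2‖ < 3 := by rw [norm_pow]; nlinarith [norm_nonneg z]
    simpa using one_sub_ne_zero_of_norm_lt (c := 3) (by norm_num) h
  have hsub : ball (0 : ℂ) 1 ⊆ ball 0 (3 / 2) := ball_subset_ball (by norm_num)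
  have hopen : IsOpen (nephroidPrimitive '' ball 0 1) :=
    isOpen_image_of_deriv_ne_zero isOpen_ball differentiable_nephroidPrimitive.differentiableOn
      (fun z hz => hdne z (hsub hz))
  obtain ⟨g, hg⟩ := exists_differentiableAt_leftInverse isOpen_ball
    differentiable_nephroidPrimitive.differentiableOn injOn_nephroidPrimitive hdne
  rw [mem_ball_zero_iff] at hz₁
  have hcb : closedBall (0 : ℂ) ‖z₁‖ ⊆ ball 0 1 := closedBall_subset_ball hz₁
  have hE : IsCompact (closedBall (0 : ℂ) ‖z₁‖ ∩ f ⁻¹' (nephroidPrimitive '' ball 0 1)ᶜ) :=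
    (isCompact_closedBall _ _).of_isClosed_subset
      ((hf.continuousOn.mono hcb).preimage_isClosed_of_isClosed isClosed_closedBall
        hopen.isClosed_compl) inter_subset_left
  -- An escape point of least modulus: f maps the smaller open disk into the image, so Q⁻¹∘f is
  -- defined there and reaches the unit circle at z₀.
  obtain ⟨z₀, ⟨hz₀, hz₀f⟩, hmin⟩ := hE.exists_isMinOn ⟨z₁, by simp, hz₁f⟩
    continuous_norm.continuousOn
  have hz₀1 : z₀ ∈ ball (0 : ℂ) 1 := hcb hz₀
  have hz₀0 : z₀ ≠ 0 := by
    rintro rfl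
    exact hz₀f ⟨0, by simp, by simp [nephroidPrimitive, hf0]⟩
  have hr : 0 < ‖z₀‖ := norm_pos_iff.2 hz₀0
  have hin : ∀ z ∈ ball (0 : ℂ) ‖z₀‖, f z ∈ nephroidPrimitive '' ball 0 1 := by
    intro z hz
    by_contra hzf
    rw [mem_ball_zero_iff] at hz
    rw [mem_closedBall_zero_iff] at hz₀
    have := hmin (a := z) ⟨by rw [mem_closedBall_zero_iff]; exact hz.le.trans hz₀, hzf⟩
    exact absurd hz (not_lt.2 this)
  have hcl : f z₀ ∈ closure (nephroidPrimitive '' ball 0 1) := by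
    have hc : ContinuousWithinAt f (ball 0 ‖z₀‖) z₀ :=
      ((hf z₀ hz₀1).continuousWithinAt).mono
        (ball_subset_ball (mem_ball_zero_iff.1 hz₀1).le)
    refine hc.mem_closure ?_ hin
    rw [closure_ball _ hr.ne']; simp
  obtain ⟨ζ, hζ, hζf⟩ := closure_image_ball_subset
    differentiable_nephroidPrimitive.continuous.continuousOn hcl
  have hζ1 : ‖ζ‖ = 1 := by
    rcases (mem_closedBall_zero_iff.1 hζ).lt_or_eq with h | h
    · exact absurd ⟨ζ, mem_ball_zero_iff.2 h, hζf⟩ hz₀f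
    · exact h
  have hζS : ζ ∈ ball (0 : ℂ) (3 / 2) := by rw [mem_ball_zero_iff, hζ1]; norm_num
  have hfd : ∀ z ∈ ball (0 : ℂ) 1, DifferentiableAt ℂ f z := fun z hz =>
    hf.differentiableAt (isOpen_ball.mem_nhds hz)
  have hv0 : g (f z₀) = ζ := by rw [← hζf]; exact (hg ζ hζS).1
  have hgd : DifferentiableAt ℂ g (f z₀) := by rw [← hζf]; exact (hg ζ hζS).2
  have hder : HasDerivAt (fun z => g (f z)) (deriv g (f z₀) * deriv f z₀) z₀ :=
    hgd.hasDerivAt.comp z₀ (hfd z₀ hz₀1).hasDerivAt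
  obtain ⟨m, hm, hjack⟩ := jack_lemma (v := fun z => g (f z)) hr rfl (fun z hz => by
      obtain ⟨a, ha, haf⟩ := hin z hz
      have h1 : DifferentiableAt ℂ g (f z) := by rw [← haf]; exact (hg a (hsub ha)).2
      exact (h1.comp z (hfd z (ball_subset_ball
        (mem_ball_zero_iff.1 hz₀1).le hz))).differentiableWithinAt) (by
      have h0 := (hg 0 (by simp)).1
      have h1 : nephroidPrimitive 0 = 0 := by simp [nephroidPrimitive]
      simp only [hf0]; rwa [h1] at h0) (fun z hz => by
      obtain ⟨a, ha, haf⟩ := hin z hz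
      simp only [← haf, (hg a (hsub ha)).1]; simpa using ha) hder (by
      simp only [hv0, hζ1])
  have hQg : (1 - ζ ^ 2 / 3) * deriv g (f z₀) = 1 := by
    have hQζ : HasDerivAt nephroidPrimitive (1 - ζ ^ 2 / 3) ζ := hasDerivAt_nephroidPrimitive ζ
    have h1 : HasDerivAt (fun a => g (nephroidPrimitive a))
        (deriv g (f z₀) * (1 - ζ ^ 2 / 3)) ζ := by
      refine HasDerivAt.comp ζ (h₂ := g) ?_ hQζ
      rw [hζf]; exact hgd.hasDerivAt
    have h2 : HasDerivAt (fun a => g (nephroidPrimitive a)) 1 ζ :=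
      (hasDerivAt_id ζ).congr_of_eventuallyEq (by
        filter_upwards [isOpen_ball.mem_nhds hζS] with a ha using (hg a ha).1)
    rw [mul_comm]; exact h1.unique h2
  have hfin : z₀ * deriv f z₀ = m * (ζ - ζ ^ 3 / 3) := by
    simp only [hv0] at hjack
    linear_combination (1 - ζ ^ 2 / 3) * hjack - z₀ * deriv f z₀ * hQg
  rw [hfw z₀ hz₀1] at hfin
  have hm0 : 0 < m := by linarith
  -- For t > 0 the dilation factor is m/t ≥ 1; for t = 0 the interior point is 0.
  rcases ht.eq_or_lt with rfl | htpos
  · refine nephroid_ne_mul_of_one_le (a := 0) (by simp) hζ1 hm ?_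
    rw [← hfin]; simp
  · refine nephroid_ne_mul_of_one_le (hw z₀ hz₀1) hζ1 (m := m / t) ?_ ?_
    · rw [le_div_iff₀ htpos]; linarith
    · have : (t : ℂ) ≠ 0 := by exact_mod_cast htpos.ne'
      push_cast
      field_simp
      field_simp at hfin
      linear_combination hfin

/-! ### Logarithms of solutions and subordination from containment -/

/-- A holomorphic solution of the nephroid equation is the exponential of a holomorphic `L`. -/
theorem IsNephroidSolution.exists_log {β : ℝ} (hβ : 0 < β) {p : ℂ → ℂ}
    (hp : IsNephroidSolution β p) :
    ∃ L w : ℂ → ℂ, DifferentiableOn ℂ L (ball 0 1) ∧ L 0 = 0 ∧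
      (∀ z ∈ ball (0 : ℂ) 1, ‖w z‖ < 1) ∧
      (∀ z ∈ ball (0 : ℂ) 1, z * deriv L z = (β⁻¹ : ℝ) * (w z - w z ^ 3 / 3)) ∧
      ∀ z ∈ ball (0 : ℂ) 1, p z = Complex.exp (L z) := by
  obtain ⟨hpd, hp0, w, hwd, hw0, hw1, hpw⟩ := hp
  unfold unitDisk at *
  have hβ' : (β : ℂ) ≠ 0 := by exact_mod_cast hβ.ne'
  set H : ℂ → ℂ := fun z => w z - w z ^ 3 / 3 with hH
  have hHd : DifferentiableOn ℂ H (ball 0 1) := hwd.sub ((hwd.pow 3).div_const 3)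
  have hH0 : H 0 = 0 := by simp [hH, hw0]
  have hne : ∀ z ∈ ball (0 : ℂ) 1, p z ≠ 0 → β * (z * deriv p z) = p z * H z := by
    intro z hz hz0
    have := hpw z hz
    simp only [phiNe] at this
    field_simp at this
    simp only [hH]
    field_simp
    linear_combination this
  have hdp : DifferentiableOn ℂ (deriv p) (ball 0 1) := hpd.deriv isOpen_ball
  -- Zeros of p are isolated because p(0) = 1, so the multiplied-out equation extends over them by
  -- continuity.
  have hall : ∀ z ∈ ball (0 : ℂ) 1, β * (z * deriv p z) = p z * H z := by
    intro z hz
    have hnear : ∀ᶠ x in 𝓝[≠] z, β * (x * deriv p x) = p x * H x := by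
      have hfr : ¬ ∃ᶠ x in 𝓝[≠] z, p x = 0 := by
        intro hfr
        have := (hpd.analyticOnNhd isOpen_ball).eqOn_zero_of_preconnected_of_frequently_eq_zero
          (convex_ball (0 : ℂ) 1).isPreconnected hz hfr (show (0 : ℂ) ∈ ball 0 1 by simp)
        simp [hp0] at this
      rw [not_frequently] at hfr
      filter_upwards [hfr, nhdsWithin_le_nhds (isOpen_ball.mem_nhds hz)] with x hx hxb
        using hne x hxb hx
    have hb := isOpen_ball.mem_nhds hz
    have hc1 : ContinuousAt (fun x => β * (x * deriv p x)) z :=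
      continuousAt_const.mul (continuousAt_id.mul (hdp.continuousOn.continuousAt hb))
    have hc2 : ContinuousAt (fun x => p x * H x) z :=
      (hpd.continuousOn.continuousAt hb).mul (hHd.continuousOn.continuousAt hb)
    exact tendsto_nhds_unique_of_eventuallyEq (hc1.tendsto.mono_left nhdsWithin_le_nhds)
      (hc2.tendsto.mono_left nhdsWithin_le_nhds) hnear
  have hb0 : ball (0 : ℂ) 1 ∈ 𝓝 (0 : ℂ) := ball_mem_nhds 0 one_pos
  -- `dslope` removes the singularity of H(z)/z at 0; L will be a primitive of G.
  set G : ℂ → ℂ := fun z => (β : ℂ)⁻¹ * dslope H 0 z with hG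
  have hGd : DifferentiableOn ℂ G (ball 0 1) :=
    ((Complex.differentiableOn_dslope hb0).2 hHd).const_mul _
  have hzG : ∀ z, z * G z = (β : ℂ)⁻¹ * H z := by
    intro z
    have := sub_smul_dslope H 0 z
    rw [hH0, sub_zero, sub_zero, smul_eq_mul] at this
    simp only [hG]; rw [← this]; ring
  have hpG : ∀ z ∈ ball (0 : ℂ) 1, deriv p z = p z * G z := by
    have hne0 : ∀ z ∈ ball (0 : ℂ) 1, z ≠ 0 → deriv p z = p z * G z := by
      intro z hz hz0
      have h1 := hall z hz
      have h2 := hzG z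
      refine mul_left_cancel₀ (mul_ne_zero hβ' hz0) ?_
      calc (β : ℂ) * z * deriv p z = p z * H z := by rw [mul_assoc]; exact h1
        _ = β * p z * ((β : ℂ)⁻¹ * H z) := by field_simp
        _ = _ := by rw [← h2]; ring
    intro z hz
    rcases eq_or_ne z 0 with rfl | hz0
    · refine tendsto_nhds_unique_of_eventuallyEq (l := 𝓝[≠] (0 : ℂ))
        ((hdp.continuousOn.continuousAt hb0).tendsto.mono_left nhdsWithin_le_nhds)
        (((hpd.continuousOn.continuousAt hb0).mul
          (hGd.continuousOn.continuousAt hb0)).tendsto.mono_left nhdsWithin_le_nhds) ?_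
      filter_upwards [self_mem_nhdsWithin, nhdsWithin_le_nhds hb0] with x hx hxb
        using hne0 x hxb hx
    · exact hne0 z hz hz0
  obtain ⟨L, hL0, hLd⟩ := (hGd.isExactOn_ball).with_val_at 0 0
  refine ⟨L, w, fun z hz => (hLd z hz).differentiableAt.differentiableWithinAt, hL0, hw1, ?_, ?_⟩
  · intro z hz
    rw [(hLd z hz).deriv, hzG]; push_cast; rfl
  · intro z hz
    have hq : ∀ x ∈ ball (0 : ℂ) 1, HasDerivAt (fun x => p x * Complex.exp (-L x)) 0 x := by
      intro x hx
      have h1 := ((hpd.differentiableAt (isOpen_ball.mem_nhds hx)).hasDerivAt).mul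
        ((hLd x hx).neg.cexp)
      refine h1.congr_deriv ?_
      rw [hpG x hx]; ring
    have := isOpen_ball.is_const_of_deriv_eq_zero (convex_ball (0 : ℂ) 1).isPreconnected
      (fun x hx => (hq x hx).differentiableAt.differentiableWithinAt)
      (fun x hx => (hq x hx).deriv) hz (show (0 : ℂ) ∈ ball 0 1 by simp)
    simp only [hp0, hL0, neg_zero, Complex.exp_zero, mul_one] at this
    rw [Complex.exp_neg] at this
    exact (mul_inv_eq_one₀ (Complex.exp_ne_zero _)).1 this

/-- A function on the disk whose values lie in the image of a univalent `φ` is subordinate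
to `φ`. -/
theorem subordinate_of_mem_image {φ p : ℂ → ℂ} (hφ : DifferentiableOn ℂ φ unitDisk)
    (hinj : InjOn φ unitDisk) (hd : ∀ z ∈ unitDisk, deriv φ z ≠ 0)
    (hp : DifferentiableOn ℂ p unitDisk) (h0 : p 0 = φ 0)
    (hmem : ∀ z ∈ unitDisk, p z ∈ φ '' unitDisk) : Subordinate p φ := by
  obtain ⟨g, hg⟩ := exists_differentiableAt_leftInverse isOpen_ball hφ hinj hd
  refine ⟨fun z => g (p z), fun z hz => ?_, ?_, fun z hz => ?_, fun z hz => ?_⟩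
  · obtain ⟨a, ha, hap⟩ := hmem z hz
    have h1 : DifferentiableAt ℂ g (p z) := by rw [← hap]; exact (hg a ha).2
    exact (h1.comp z (hp.differentiableAt (isOpen_ball.mem_nhds hz))).differentiableWithinAt
  · simp only [h0]; exact (hg 0 (by simp)).1
  · obtain ⟨a, ha, hap⟩ := hmem z hz
    simp only [← hap, (hg a ha).1]; simpa [unitDisk] using ha
  · obtain ⟨a, ha, hap⟩ := hmem z hz
    simp only [← hap, (hg a ha).1]

/-! ### Bounds on the exponentiated primitive and the general criterion -/

theorem norm_sq_eq_one {ζ : ℂ} (h : ‖ζ‖ = 1) : ζ.re ^ 2 + ζ.im ^ 2 = 1 := by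
  have := Complex.sq_norm ζ
  rw [h, Complex.normSq_apply] at this
  linarith

theorem abs_re_nephroidPrimitive_lt {z : ℂ} (hz : ‖z‖ < 1) :
    |(nephroidPrimitive z).re| < 8 / 9 := by
  obtain ⟨x, y⟩ := z
  have h2 : x ^ 2 + y ^ 2 < 1 := by
    have := Complex.sq_norm (⟨x, y⟩ : ℂ)
    rw [Complex.normSq_mk] at this
    nlinarith [norm_nonneg (⟨x, y⟩ : ℂ)]
  have hre : (nephroidPrimitive ⟨x, y⟩).re = x - (x ^ 3 - 3 * x * y ^ 2) / 9 := by
    simp [nephroidPrimitive, pow_succ]; ring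
  have hbd : ∀ s : ℝ, 0 ≤ s → s ^ 2 + y ^ 2 < 1 →
      |s - (s ^ 3 - 3 * s * y ^ 2) / 9| < 8 / 9 := by
    intro s h0 h1
    have hs : s < 1 := by nlinarith [sq_nonneg y]
    -- After replacing y² by 1 - s², the gap to 8/9 is (4/9)(1 - s)²(2 + s).
    have h3 : 0 < (1 - s) ^ 2 * (2 + s) := mul_pos (pow_pos (sub_pos.2 hs) 2) (by linarith)
    have h4 : 0 ≤ s * (1 - (s ^ 2 + y ^ 2)) := mul_nonneg h0 (by linarith)
    have h5 : 0 ≤ s * y ^ 2 := by positivity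
    rw [abs_lt]
    constructor <;> nlinarith
  rw [hre]
  rcases le_total 0 x with h | h
  · exact hbd x h h2
  · rw [← abs_neg]
    convert hbd (-x) (by linarith) (by linarith) using 2
    ring

theorem norm_nephroidPrimitive_le {z : ℂ} (hz : ‖z‖ ≤ 1) : ‖nephroidPrimitive z‖ ≤ 10 / 9 := by
  have h := norm_sub_le z (z ^ 3 / 9)
  rw [norm_div, norm_pow] at h
  have : ‖z‖ ^ 3 ≤ 1 := pow_le_one₀ (norm_nonneg z) hz
  norm_num at h
  unfold nephroidPrimitive
  linarith

/-- Since e^u - 1 = ∫₀¹ u e^{su} ds, the right side is |u| ∫₀¹ e^{sℓ} ds. -/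
theorem norm_exp_sub_one_le_of_re_le {u : ℂ} {ℓ : ℝ} (hℓ : 0 < ℓ) (hre : u.re ≤ ℓ) :
    ‖Complex.exp u - 1‖ ≤ ‖u‖ / ℓ * (Real.exp ℓ - 1) := by
  have hf : ∀ s : ℝ, HasDerivAt (fun s : ℝ => Complex.exp (s * u) - 1)
      (Complex.exp (s * u) * u) s := by
    intro s
    have h1 : HasDerivAt (fun s : ℝ => (s : ℂ)) 1 s := Complex.ofRealCLM.hasDerivAt
    simpa using ((h1.mul_const u).cexp).sub_const 1
  have hB : ∀ s : ℝ, HasDerivAt (fun s : ℝ => ‖u‖ / ℓ * (Real.exp (s * ℓ) - 1))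
      (‖u‖ * Real.exp (s * ℓ)) s := by
    intro s
    have h1 := ((((hasDerivAt_id s).mul_const ℓ).exp).sub_const 1).const_mul (‖u‖ / ℓ)
    refine h1.congr_deriv ?_
    simp; field_simp
  have := image_norm_le_of_norm_deriv_right_le_deriv_boundary (a := 0) (b := 1)
    (f := fun s : ℝ => Complex.exp (s * u) - 1)
    (f' := fun s : ℝ => Complex.exp (s * u) * u)
    (B := fun s : ℝ => ‖u‖ / ℓ * (Real.exp (s * ℓ) - 1))
    (fun s _ => (hf s).continuousAt.continuousWithinAt) (fun s _ => (hf s).hasDerivWithinAt)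
    (by simp) hB (fun s hs => by
      rw [norm_mul, Complex.norm_exp, mul_comm]
      gcongr
      simp only [Complex.mul_re, Complex.ofReal_re, Complex.ofReal_im, zero_mul, sub_zero]
      gcongr
      exact hs.1) (right_mem_Icc.2 zero_le_one)
  simpa using this

/-- Bounds satisfied by every value of `exp ((9/8) * log E * nephroidPrimitive v)`, `v ∈ 𝔻`. -/
structure NephroidExpBounds (E : ℝ) (a : ℂ) : Prop where
  norm_lt : ‖a‖ < E
  inv_lt_norm : E⁻¹ < ‖a‖
  norm_sub_one_le : ‖a - 1‖ ≤ 5 / 4 * (E - 1)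
  le_re : E⁻¹ * (1 - 25 / 32 * Real.log E ^ 2) ≤ a.re

/-- With u = (9/8)(log E) Q(v), the bounds 8/9 and 10/9 become log E and (5/4) log E. The constant
25/32 = (5/4)²/2 comes from cos s ≥ 1 - s²/2 at s = Im u. -/
theorem nephroidExpBounds_exp {E : ℝ} (hE : 1 < E) (hlog : 25 / 32 * Real.log E ^ 2 ≤ 1) {u : ℂ}
    (hre : |u.re| < Real.log E)
    (hu : ‖u‖ ≤ 5 / 4 * Real.log E) : NephroidExpBounds E (Complex.exp u) := by
  have hE0 : 0 < E := by linarith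
  have hℓ := Real.log_pos hE
  rw [abs_lt] at hre
  have hlow : E⁻¹ < Real.exp u.re := by
    rw [← Real.exp_log (inv_pos.2 hE0), Real.log_inv]; exact Real.exp_lt_exp.2 hre.1
  refine ⟨?_, ?_, ?_, ?_⟩
  · rw [Complex.norm_exp, ← Real.lt_log_iff_exp_lt hE0]; exact hre.2
  · rw [Complex.norm_exp]; exact hlow
  · refine (norm_exp_sub_one_le_of_re_le hℓ hre.2.le).trans ?_
    rw [Real.exp_log hE0]
    have : ‖u‖ / Real.log E ≤ 5 / 4 := by rw [div_le_iff₀ hℓ]; exact hu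
    gcongr
  · rw [Complex.exp_re]
    have h1 : |u.im| ≤ 5 / 4 * Real.log E := (Complex.abs_im_le_norm u).trans hu
    have h2 : u.im ^ 2 ≤ (5 / 4 * Real.log E) ^ 2 := sq_le_sq' (abs_le.1 h1).1 (abs_le.1 h1).2
    have h3 := Real.one_sub_sq_div_two_le_cos (x := u.im)
    have h4 : 1 - 25 / 32 * Real.log E ^ 2 ≤ Real.cos u.im := by linarith
    exact mul_le_mul hlow.le h4 (by linarith) (Real.exp_pos _).le

/-- Sufficient conditions for `(8/9) / log E` to be a sharp bound. -/
theorem isSharpNephroidBound_of_bounds {φ : ℂ → ℂ} {E : ℝ} (hE : 1 < E)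
    (hlog : 25 / 32 * Real.log E ^ 2 ≤ 1)
    (hφ : ∀ z ∈ closedBall (0 : ℂ) 1, DifferentiableAt ℂ φ z) (hinj : InjOn φ unitDisk)
    (hd : ∀ z ∈ unitDisk, deriv φ z ≠ 0) (h0 : φ 0 = 1)
    (hbdry : ∀ ζ : ℂ, ‖ζ‖ = 1 → ¬ NephroidExpBounds E (φ ζ))
    (hreal : (∀ t : ℝ, E ≤ t → (t : ℂ) ∉ φ '' unitDisk) ∨
      (∀ t : ℝ, t ≤ E⁻¹ → (t : ℂ) ∉ φ '' unitDisk)) :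
    IsSharpNephroidBound φ ((8 / 9) / Real.log E) := by
  have hE0 : 0 < E := by linarith
  have hℓ := Real.log_pos hE
  have hφd : DifferentiableOn ℂ φ unitDisk := fun z hz =>
    (hφ z (ball_subset_closedBall hz)).differentiableWithinAt
  constructor
  · intro β hβ p hp
    have hβ0 : 0 < β := lt_of_lt_of_le (by positivity) hβ
    obtain ⟨L, w, hL, hL0, hw, hLw, hpL⟩ := hp.exists_log hβ0
    set c : ℝ := 9 / 8 * Real.log E with hc
    have hc0 : 0 < c := by positivity
    have hc0' : (c : ℂ) ≠ 0 := by exact_mod_cast hc0.ne'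
    have hβc : 1 ≤ c * β := by
      rw [div_le_iff₀ hℓ] at hβ; rw [hc]; linarith
    have hmem := mem_image_nephroidPrimitive (f := fun z => (c : ℂ)⁻¹ * L z) (w := w)
      (t := (c * β)⁻¹) (by positivity) (inv_le_one_of_one_le₀ hβc) (hL.const_mul _)
      (by simp [hL0]) hw (fun z hz => by
        rw [deriv_const_mul _ (hL.differentiableAt (isOpen_ball.mem_nhds hz))]
        have := hLw z hz
        push_cast at this ⊢
        rw [mul_inv, mul_assoc, ← this]; ring)
    -- Connectedness: the set contains 1 = φ(0) and misses φ of the unit circle.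
    have hV : (fun v => Complex.exp (c * nephroidPrimitive v)) '' ball (0 : ℂ) 1
        ⊆ φ '' ball 0 1 := by
      have hcont : Continuous (fun v => Complex.exp (c * nephroidPrimitive v)) :=
        (continuous_const.mul differentiable_nephroidPrimitive.continuous).cexp
      refine ((convex_ball (0 : ℂ) 1).isPreconnected.image _ hcont.continuousOn).subset_image_ball
        (isOpen_image_of_deriv_ne_zero isOpen_ball hφd hd)
        (fun z hz => (hφ z hz).continuousAt.continuousWithinAt) ?_ ?_
      · exact ⟨1, ⟨0, by simp, by simp [nephroidPrimitive]⟩, ⟨0, by simp, h0⟩⟩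
      · rintro ζ hζ ⟨v, hv, hvζ⟩
        rw [mem_ball_zero_iff] at hv
        refine hbdry ζ (by simpa using hζ) ?_
        rw [← hvζ]
        refine nephroidExpBounds_exp hE hlog ?_ ?_
        · rw [Complex.re_ofReal_mul, abs_mul, abs_of_pos hc0, hc]
          nlinarith [abs_re_nephroidPrimitive_lt hv]
        · rw [norm_mul, Complex.norm_real, Real.norm_of_nonneg hc0.le, hc]
          nlinarith [norm_nephroidPrimitive_le hv.le]
    refine subordinate_of_mem_image hφd hinj hd hp.1 (by rw [hp.2.1, h0]) fun z hz => ?_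
    rw [hpL z hz]
    obtain ⟨v, hv, hvz⟩ := hmem z hz
    refine hV ⟨v, hv, ?_⟩
    simp only [hvz]
    rw [mul_inv_cancel_left₀ hc0']
  · intro β hβ0 hβ
    have hβ' : (β : ℂ) ≠ 0 := by exact_mod_cast hβ0.ne'
    -- The extremal solution, with w = id.
    set p : ℂ → ℂ := fun z => Complex.exp (nephroidPrimitive z / β) with hp
    have hpd : ∀ z, HasDerivAt p (Complex.exp (nephroidPrimitive z / β) *
        ((1 - z ^ 2 / 3) / β)) z := fun z => ((hasDerivAt_nephroidPrimitive z).div_const _).cexp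
    refine ⟨p, ⟨fun z _ => (hpd z).differentiableAt.differentiableWithinAt,
      by simp [hp, nephroidPrimitive], id, differentiableOn_id, rfl,
      fun z hz => by simpa [unitDisk] using hz, fun z _ => ?_⟩,
      fun z _ => Complex.exp_ne_zero _, ?_⟩
    · simp only [(hpd z).deriv]
      have := Complex.exp_ne_zero (nephroidPrimitive z / β)
      simp only [hp, phiNe, id]
      field_simp
      ring
    -- Q(x) → 8/9 as x → 1, and (8/9)/β > log E. Since Q is odd, p(-x) = 1/p(x) serves the other
    -- side.
    · have hx : ∃ x : ℝ, 0 < x ∧ x < 1 ∧ E ≤ Real.exp ((x - x ^ 3 / 9) / β) := by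
        have hc : ContinuousAt (fun x : ℝ => Real.exp ((x - x ^ 3 / 9) / β)) 1 := by fun_prop
        have h1 : E < Real.exp ((1 - 1 ^ 3 / 9) / β) := by
          rw [← Real.log_lt_iff_lt_exp hE0, lt_div_iff₀ hβ0]
          rw [lt_div_iff₀ hℓ] at hβ; linarith
        have h2 := (hc.eventually (lt_mem_nhds h1)).filter_mono
          (nhdsWithin_le_nhds (s := Iio (1 : ℝ)))
        obtain ⟨x, h3, h4⟩ := (h2.and (Ioo_mem_nhdsLT (show (0 : ℝ) < 1 by norm_num))).exists
        exact ⟨x, h4.1, h4.2, h3.le⟩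
      obtain ⟨x, hx0, hx1, hxE⟩ := hx
      rintro ⟨w, -, -, hw1, hpw⟩
      rcases hreal with hr | hr
      · refine hr _ hxE ⟨w x, by simpa [unitDisk] using hw1 x (by
          simp [unitDisk, abs_of_pos hx0, hx1]), ?_⟩
        rw [← hpw x (by simp [unitDisk, abs_of_pos hx0, hx1])]
        simp [hp, nephroidPrimitive]
      · have hneg : Real.exp (-((x - x ^ 3 / 9) / β)) ≤ E⁻¹ := by
          rw [Real.exp_neg]; gcongr
        refine hr _ hneg ⟨w (-x), by simpa [unitDisk] using hw1 (-x) (by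
          simp [unitDisk, abs_of_pos hx0, hx1]), ?_⟩
        rw [← hpw (-x) (by simp [unitDisk, abs_of_pos hx0, hx1])]
        simp only [hp, nephroidPrimitive]
        push_cast
        congr 1; ring

/-! ### The nephroid function, E = φ_Ne(1) = 5/3 -/

/-- On the circle, |φ|² = 25/9 + (4/3)x(1 - x)(3 + 2x), so |φ| < 5/3 forces x < 0. Next, |φ - 1|² =
4/9 + (4/3)(1 - x²) ≤ (5/6)² forces x near -1. There Re φ ≤ 1/3, below the required (3/5)(47/72). -/
theorem not_nephroidExpBounds_phiNe {ζ : ℂ} (hζ : ‖ζ‖ = 1) :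
    ¬ NephroidExpBounds (5 / 3) (phiNe ζ) := by
  rintro ⟨h1, -, h3, h4⟩
  have hlog : Real.log (5 / 3) ≤ 2 / 3 := by
    have := Real.log_le_sub_one_of_pos (show (0 : ℝ) < 5 / 3 by norm_num); linarith
  have hlog0 : 0 < Real.log (5 / 3) := Real.log_pos (by norm_num)
  have hlog2 : Real.log (5 / 3) ^ 2 ≤ 4 / 9 := by nlinarith
  obtain ⟨x, y⟩ := ζ
  have hxy := norm_sq_eq_one hζ
  simp only at hxy
  have hx1 : x ≤ 1 := by nlinarith [sq_nonneg y]
  have hx2 : -1 ≤ x := by nlinarith [sq_nonneg y]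
  have hre : (phiNe ⟨x, y⟩).re = 1 + x - (x ^ 3 - 3 * x * y ^ 2) / 3 := by
    simp [phiNe, pow_succ]; ring
  have him : (phiNe ⟨x, y⟩).im = y - (3 * x ^ 2 * y - y ^ 3) / 3 := by
    simp [phiNe, pow_succ]; ring
  have hy2 : y ^ 2 = 1 - x ^ 2 := by linarith
  have hre' : (phiNe ⟨x, y⟩).re = 1 + 2 * x - (4 / 3) * x ^ 3 := by
    rw [hre]; linear_combination x * hy2
  have him' : (phiNe ⟨x, y⟩).im = (4 / 3) * y ^ 3 := by
    rw [him]; linear_combination (-y) * hxy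
  have hn1 := Complex.sq_norm (phiNe ⟨x, y⟩)
  rw [Complex.normSq_apply, hre', him'] at hn1
  have hn2 := Complex.sq_norm (phiNe ⟨x, y⟩ - 1)
  rw [Complex.normSq_apply, Complex.sub_re, Complex.sub_im, hre', him', Complex.one_re,
    Complex.one_im] at hn2
  rw [hre'] at h4
  have hy6 : y ^ 3 * y ^ 3 = (1 - x ^ 2) ^ 3 := by rw [← hy2]; ring
  have hlt : ‖phiNe ⟨x, y⟩‖ ^ 2 < 25 / 9 := by
    have := pow_lt_pow_left₀ h1 (norm_nonneg _) two_ne_zero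
    norm_num at this; exact this
  have hle : ‖phiNe ⟨x, y⟩ - 1‖ ^ 2 ≤ 25 / 36 := by
    have := pow_le_pow_left₀ (norm_nonneg _) h3 2
    norm_num at this; exact this
  have e1 : x * ((1 - x) * (3 + 2 * x)) < 0 := by
    have : ‖phiNe ⟨x, y⟩‖ ^ 2 = 25 / 9 + 4 * (x * ((1 - x) * (3 + 2 * x))) / 3 := by
      rw [hn1]; linear_combination (16 / 9) * hy6
    linarith
  have hx0 : x < 0 := by
    by_contra hx0
    push Not at hx0
    have : 0 ≤ x * ((1 - x) * (3 + 2 * x)) :=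
      mul_nonneg hx0 (mul_nonneg (by linarith) (by linarith))
    linarith
  have e2 : x ^ 2 ≥ 13 / 16 := by
    have : ‖phiNe ⟨x, y⟩ - 1‖ ^ 2 = 4 / 9 + (4 / 3) * (1 - x ^ 2) := by
      rw [hn2]; linear_combination (16 / 9) * hy6
    linarith
  have hx9 : x ≤ -(9 / 10) := by
    by_contra hx9
    have := mul_pos (show 0 < x + 9 / 10 by linarith) (neg_pos.2 hx0)
    linarith
  have e3 : 0 ≤ (x + 1) * (2 * x ^ 2 - 2 * x - 1) :=
    mul_nonneg (by linarith) (by linarith)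
  have e4 : (5 / 3 : ℝ)⁻¹ * (1 - 25 / 32 * Real.log (5 / 3) ^ 2) ≥ 3 / 5 * (47 / 72) := by
    norm_num; linarith
  have e5 : (x + 1) * (2 * x ^ 2 - 2 * x - 1) = 2 * x ^ 3 - 3 * x - 1 := by ring
  linarith

theorem isSharpNephroidBound_phiNe :
    IsSharpNephroidBound phiNe ((8 / 9 : ℝ) / Real.log (5 / 3)) := by
  have hder : ∀ z, HasDerivAt phiNe (1 - z ^ 2) z := by
    intro z
    have := ((hasDerivAt_id z).const_add 1).sub ((hasDerivAt_pow 3 z).div_const 3)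
    refine this.congr_deriv ?_
    norm_num
  have hlog : Real.log (5 / 3) ≤ 2 / 3 := by
    have := Real.log_le_sub_one_of_pos (show (0 : ℝ) < 5 / 3 by norm_num); linarith
  have hlog0 : 0 < Real.log (5 / 3) := Real.log_pos (by norm_num)
  have hlog2 : Real.log (5 / 3) ^ 2 ≤ 4 / 9 := by nlinarith
  refine isSharpNephroidBound_of_bounds (by norm_num) (by linarith)
    (fun z _ => (hder z).differentiableAt) ?_ ?_ (by simp [phiNe]) ?_ (Or.inl ?_)
  · intro a ha b hb hab
    rw [unitDisk, mem_ball_zero_iff] at ha hb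
    have h := one_sub_ne_zero_of_norm_lt (c := 3) (by norm_num)
      ((norm_sq_add_mul_add_sq_lt ha hb.le).trans_le (by norm_num))
    have h2 : (a - b) * (1 - (a ^ 2 + a * b + b ^ 2) / (3 : ℝ)) = 0 := by
      unfold phiNe at hab
      push_cast
      linear_combination hab
    exact sub_eq_zero.1 ((mul_eq_zero.1 h2).resolve_right h)
  · intro z hz
    rw [unitDisk, mem_ball_zero_iff] at hz
    rw [(hder z).deriv]
    have : ‖z ^ 2‖ < 1 := by rw [norm_pow]; nlinarith [norm_nonneg z]
    simpa using one_sub_ne_zero_of_norm_lt one_pos this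
  · exact fun ζ hζ => not_nephroidExpBounds_phiNe hζ
  · rintro t ht ⟨⟨x, y⟩, hz, hzt⟩
    rw [unitDisk, mem_ball_zero_iff] at hz
    have hxy : x ^ 2 + y ^ 2 < 1 := by
      have := Complex.sq_norm (⟨x, y⟩ : ℂ)
      rw [Complex.normSq_mk] at this
      nlinarith [norm_nonneg (⟨x, y⟩ : ℂ)]
    have hre : 1 + x - (x ^ 3 - 3 * x * y ^ 2) / 3 = t := by
      have := congrArg Complex.re hzt
      simp [phiNe, pow_succ] at this; rw [← this]; ring
    have him : y * (1 - x ^ 2 + y ^ 2 / 3) = 0 := by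
      have := congrArg Complex.im hzt
      simp [phiNe, pow_succ] at this; linarith
    have hy : y = 0 := (mul_eq_zero.1 him).resolve_right (by nlinarith [sq_nonneg y])
    subst hy
    have hx1 : x < 1 := by nlinarith
    have hx2 : -1 < x := by nlinarith
    nlinarith [mul_pos (pow_pos (sub_pos.2 hx1) 2) (show 0 < 2 + x by linarith)]

/-! ### The rational function, 1/E = φ₀(-1) = 2/k -/

/-- The constant `k = 1 + √2` of `phi0`. -/
noncomputable def silverConst : ℝ := 1 + Real.sqrt 2

theorem silverConst_sq : silverConst ^ 2 = 2 * silverConst + 1 := by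
  have := Real.sq_sqrt (show (0 : ℝ) ≤ 2 by norm_num)
  unfold silverConst; linear_combination this

theorem two_lt_silverConst : 2 < silverConst := by
  have : 1 < Real.sqrt 2 := Real.lt_sqrt_of_sq_lt (by norm_num)
  unfold silverConst; linarith

theorem silverConst_sub_ne_zero {z : ℂ} (hz : ‖z‖ ≤ 1) : (silverConst : ℂ) - z ≠ 0 := by
  intro h
  rw [sub_eq_zero] at h
  rw [← h, Complex.norm_real, Real.norm_of_nonneg (by linarith [two_lt_silverConst])] at hz
  linarith [two_lt_silverConst]

theorem phi0_eq {z : ℂ} (hz : ‖z‖ ≤ 1) :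
    phi0 z = (silverConst ^ 2 + z ^ 2) / (silverConst * (silverConst - z)) := by
  have h1 := silverConst_sub_ne_zero hz
  have h2 : (silverConst : ℂ) ≠ 0 := by
    exact_mod_cast (by linarith [two_lt_silverConst] : silverConst ≠ 0)
  change 1 + z / (silverConst : ℂ) * ((silverConst + z) / (silverConst - z)) = _
  field_simp
  ring

/-- |ab - k(a + b)| < 1 + 2k = k². This factor of φ₀(a) - φ₀(b) yields injectivity and, at a = b,
the nonvanishing derivative. -/
theorem silverConst_quadratic_ne_zero {a b : ℂ} (ha : ‖a‖ < 1) (hb : ‖b‖ < 1) :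
    (silverConst : ℂ) ^ 2 + silverConst * (a + b) - a * b ≠ 0 := by
  intro h
  have hk := two_lt_silverConst
  have h1 : (silverConst : ℂ) ^ 2 = a * b - silverConst * (a + b) := by linear_combination h
  have h2 := congrArg norm h1
  rw [norm_pow, Complex.norm_real, Real.norm_of_nonneg (by linarith), silverConst_sq] at h2
  have h3 := norm_sub_le (a * b) (silverConst * (a + b))
  rw [norm_mul, norm_mul, Complex.norm_real, Real.norm_of_nonneg (by linarith)] at h3
  have h4 : ‖a‖ * ‖b‖ ≤ 1 := mul_le_one₀ ha.le (norm_nonneg b) hb.le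
  have h5 : silverConst * ‖a + b‖ < silverConst * 2 := by
    have := norm_add_le a b
    gcongr
    linarith
  linarith

theorem hasDerivAt_phi0 {z : ℂ} (hz : ‖z‖ ≤ 1) :
    HasDerivAt phi0 ((silverConst ^ 2 + silverConst * (z + z) - z * z) /
      (silverConst * (silverConst - z) ^ 2)) z := by
  have h1 := silverConst_sub_ne_zero hz
  have h2 : (silverConst : ℂ) ≠ 0 := by
    exact_mod_cast (by linarith [two_lt_silverConst] : silverConst ≠ 0)
  have hA := (hasDerivAt_id z).div_const (silverConst : ℂ)
  have hB := ((hasDerivAt_id z).const_add (silverConst : ℂ)).div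
    ((hasDerivAt_id z).const_sub (silverConst : ℂ)) h1
  refine ((hA.mul hB).const_add 1).congr_deriv ?_
  simp only [id, Pi.div_apply]
  field_simp
  ring

/-- Via k² = 2k + 1, the bound |φ₀| > 2/k becomes (x + 1)((2k + 1)x - 1) > 0, hence x > 0. The bound
on |φ₀ - 1| becomes |k + ζ| ≤ (5/8)|k - ζ|, impossible for x > 0. -/
theorem not_nephroidExpBounds_phi0 {ζ : ℂ} (hζ : ‖ζ‖ = 1) :
    ¬ NephroidExpBounds (silverConst / 2) (phi0 ζ) := by
  rintro ⟨-, h2, h3, -⟩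
  have hk := two_lt_silverConst
  have hk2 := silverConst_sq
  have hk0 : 0 < silverConst := by linarith
  have hne := silverConst_sub_ne_zero hζ.le
  have hpos : 0 < ‖(silverConst : ℂ) - ζ‖ := norm_pos_iff.2 hne
  have hkn : ‖(silverConst : ℂ)‖ = silverConst := by
    rw [Complex.norm_real, Real.norm_of_nonneg hk0.le]
  have hk' : (silverConst : ℂ) ≠ 0 := by exact_mod_cast hk0.ne'
  have hsub : phi0 ζ - 1 = ζ * (silverConst + ζ) / (silverConst * (silverConst - ζ)) := by
    rw [phi0_eq hζ.le]; field_simp; ring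
  rw [hsub, norm_div, norm_mul, norm_mul, hζ, hkn, one_mul, div_le_iff₀ (by positivity)] at h3
  rw [phi0_eq hζ.le, norm_div, norm_mul, hkn, lt_div_iff₀ (by positivity)] at h2
  have h2' : 2 * ‖(silverConst : ℂ) - ζ‖ < ‖(silverConst : ℂ) ^ 2 + ζ ^ 2‖ := by
    refine lt_of_eq_of_lt ?_ h2
    field_simp
  have h3' : ‖(silverConst : ℂ) + ζ‖ ≤ 5 / 8 * ‖(silverConst : ℂ) - ζ‖ := by
    refine h3.trans_eq ?_
    linear_combination (5 / 8 * ‖(silverConst : ℂ) - ζ‖) * hk2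
  have hxy := norm_sq_eq_one hζ
  obtain ⟨x, y⟩ := ζ
  simp only at hxy
  have hx2 : -1 ≤ x := by nlinarith [sq_nonneg y]
  have n1 := Complex.sq_norm ((silverConst : ℂ) - ⟨x, y⟩)
  have n2 := Complex.sq_norm ((silverConst : ℂ) + ⟨x, y⟩)
  have n3 := Complex.sq_norm ((silverConst : ℂ) ^ 2 + ⟨x, y⟩ ^ 2)
  rw [Complex.normSq_apply] at n1 n2 n3
  simp [pow_two] at n1 n2 n3
  have s2 := pow_lt_pow_left₀ h2' (by positivity) two_ne_zero
  have s3 := pow_le_pow_left₀ (norm_nonneg _) h3' 2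
  generalize silverConst = k at *
  have hy2 : y ^ 2 = 1 - x ^ 2 := by linarith
  have d1 : ‖(k : ℂ) - ⟨x, y⟩‖ ^ 2 = 2 * k + 2 - 2 * k * x := by
    rw [pow_two, n1]; linear_combination hk2 + hxy
  have d2 : ‖(k : ℂ) + ⟨x, y⟩‖ ^ 2 = 2 * k + 2 + 2 * k * x := by
    rw [pow_two, n2]; linear_combination hk2 + hxy
  have d3 : ‖(k : ℂ) ^ 2 + ⟨x, y⟩ ^ 2‖ ^ 2
      = 8 * k + 4 + (8 * k + 4) * x ^ 2 := by
    rw [pow_two (k : ℂ), pow_two (⟨x, y⟩ : ℂ), pow_two ‖_‖, n3]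
    linear_combination (k ^ 2 + 2 * k + 3 + 4 * x ^ 2) * hk2 +
      (y ^ 2 + 1 + x ^ 2 - 2 * k ^ 2) * hxy
  rw [mul_pow, d1] at s2 s3
  rw [d3] at s2
  rw [d2] at s3
  have e1 : 0 < (x + 1) * ((2 * k + 1) * x - 1) := by linarith
  have e2 : 0 < (2 * k + 1) * x - 1 := pos_of_mul_pos_right e1 (by linarith)
  have e3 : 0 < x := pos_of_mul_pos_right (show 0 < (2 * k + 1) * x by linarith) (by linarith)
  have e4 : 0 < k * x := mul_pos hk0 e3
  linarith

theorem isSharpNephroidBound_phi0 :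
    IsSharpNephroidBound phi0 (-((8 / 9 : ℝ) / Real.log (2 * Real.sqrt 2 - 2))) := by
  have hk := two_lt_silverConst
  have hk2 := silverConst_sq
  have hk3 : silverConst < 5 / 2 := by nlinarith
  have hk' : (silverConst : ℂ) ≠ 0 := by exact_mod_cast (by linarith : silverConst ≠ 0)
  have hm : 2 * Real.sqrt 2 - 2 = (silverConst / 2)⁻¹ := by
    rw [inv_div, eq_div_iff (by linarith)]
    have := Real.sq_sqrt (show (0 : ℝ) ≤ 2 by norm_num)
    unfold silverConst; linear_combination 2 * this
  rw [hm, Real.log_inv, div_neg, neg_neg]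
  have hlog : Real.log (silverConst / 2) ≤ 1 / 4 := by
    have := Real.log_le_sub_one_of_pos (show (0 : ℝ) < silverConst / 2 by linarith); linarith
  have hlog0 : 0 < Real.log (silverConst / 2) := Real.log_pos (by linarith)
  refine isSharpNephroidBound_of_bounds (by linarith) (by nlinarith)
    (fun z hz => (hasDerivAt_phi0 (by simpa using hz)).differentiableAt) ?_ ?_ (by simp [phi0])
    (fun ζ hζ => not_nephroidExpBounds_phi0 hζ) (Or.inr ?_)
  · intro a ha b hb hab
    rw [unitDisk, mem_ball_zero_iff] at ha hb
    have h1 := silverConst_sub_ne_zero ha.le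
    have h2 := silverConst_sub_ne_zero hb.le
    rw [phi0_eq ha.le, phi0_eq hb.le, div_eq_div_iff (mul_ne_zero hk' h1)
      (mul_ne_zero hk' h2)] at hab
    have h3 : (silverConst : ℂ) * ((a - b) *
        ((silverConst : ℂ) ^ 2 + silverConst * (a + b) - a * b)) = 0 := by
      linear_combination hab
    exact sub_eq_zero.1 ((mul_eq_zero.1 ((mul_eq_zero.1 h3).resolve_left hk')).resolve_right
      (silverConst_quadratic_ne_zero ha hb))
  · intro z hz
    rw [unitDisk, mem_ball_zero_iff] at hz
    rw [(hasDerivAt_phi0 hz.le).deriv]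
    exact div_ne_zero (silverConst_quadratic_ne_zero hz hz)
      (mul_ne_zero hk' (pow_ne_zero 2 (silverConst_sub_ne_zero hz.le)))
  · rintro t ht ⟨⟨x, y⟩, hz, hzt⟩
    rw [unitDisk, mem_ball_zero_iff] at hz
    have hxy : x ^ 2 + y ^ 2 < 1 := by
      have := Complex.sq_norm (⟨x, y⟩ : ℂ)
      rw [Complex.normSq_mk] at this
      nlinarith [norm_nonneg (⟨x, y⟩ : ℂ)]
    rw [phi0_eq hz.le, div_eq_iff (mul_ne_zero hk' (silverConst_sub_ne_zero hz.le))] at hzt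
    have hre := congrArg Complex.re hzt
    have him := congrArg Complex.im hzt
    simp [pow_two] at hre him
    rw [inv_div, le_div_iff₀ (by linarith)] at ht
    generalize silverConst = k at *
    have hx1 : x < 1 := by nlinarith [sq_nonneg y]
    have hx2 : -1 < x := by nlinarith [sq_nonneg y]
    have him' : y * (2 * x + t * k) = 0 := by linarith
    -- If y = 0, then tk ≤ 2 gives (x + 1)² ≤ 0. Otherwise tk = -2x gives 2k(1 + x) + 1 - |z|² = 0,
    -- whose left side is positive.
    rcases mul_eq_zero.1 him' with rfl | h
    · have : t * k * (k - x) ≤ 2 * (k - x) := by gcongr; linarith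
      nlinarith [pow_pos (show 0 < x + 1 by linarith) 2]
    · have h' : t * k = -(2 * x) := by linarith
      have : k * k + (x * x - y * y) = -(2 * x) * (k - x) := by
        rw [hre, ← h']; ring
      nlinarith [mul_pos (show 0 < k by linarith) (show 0 < x + 1 by linarith)]

/-! ### The sine function, E = φ_S(1) = 1 + sin 1 -/

theorem one_add_sq_div_two_add_le_cosh (t : ℝ) : 1 + t ^ 2 / 2 + t ^ 4 / 24 ≤ Real.cosh t := by
  have := sum_le_hasSum (Finset.range 3) (fun n _ => by
    rw [pow_mul]; positivity) (Real.hasSum_cosh t)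
  simpa [Finset.sum_range_succ, Nat.factorial] using this

theorem sq_add_le_sinh_sq (t : ℝ) : t ^ 2 + t ^ 4 / 3 ≤ Real.sinh t ^ 2 := by
  have h1 := one_add_sq_div_two_add_le_cosh (2 * t)
  rw [Real.cosh_two_mul, Real.cosh_sq] at h1
  linarith

theorem sq_sub_le_sin_sq {x : ℝ} (hx : |x| ≤ 1) : x ^ 2 - x ^ 4 / 3 ≤ Real.sin x ^ 2 := by
  have key : ∀ s : ℝ, 0 ≤ s → s ≤ 1 → s ^ 2 - s ^ 4 / 3 ≤ Real.sin s ^ 2 := by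
    intro s h0 h1
    rcases h0.eq_or_lt with rfl | h0
    · simp
    have h2 := (Real.sin_gt_sub_cube h0).le
    have h3 : 0 ≤ s - s ^ 3 / 6 := by nlinarith [pow_le_one₀ h0.le h1 (n := 2)]
    have h4 := pow_le_pow_left₀ h3 h2 2
    nlinarith [pow_pos h0 6]
  rw [abs_le] at hx
  rcases le_total 0 x with h | h
  · exact key x h hx.2
  · have := key (-x) (by linarith) (by linarith)
    rwa [Real.sin_neg, neg_sq, neg_sq, Even.neg_pow (by decide)] at this

theorem sin_one_le : Real.sin 1 ≤ 253 / 300 := by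
  have := (abs_le.1 (Real.sin_bound (x := 1) (by simp))).2
  norm_num at this; linarith

theorem sub_cube_le_sin {x : ℝ} (hx : 0 < x) : x - x ^ 3 / 6 ≤ Real.sin x :=
  (Real.sin_gt_sub_cube hx).le

theorem log_one_add_sin_one_le : Real.log (1 + Real.sin 1) ≤ 31 / 50 := by
  have h1 := sub_cube_le_sin one_pos
  rw [Real.log_le_iff_le_exp (by linarith)]
  have h2 := Real.sum_le_exp_of_nonneg (show (0 : ℝ) ≤ 31 / 50 by norm_num) 4
  simp [Finset.sum_range_succ, Nat.factorial] at h2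
  norm_num at h2
  linarith [sin_one_le]

/-- The right side is |1 + sin ζ|², with equality at ζ = 1. Lowering x from 1 costs at most a
multiple of sin 1 - sin x ≤ (37/50)(1 - x), while the hyperbolic terms gain through y² = (1 - x)(1 +
x). Cancelling 1 - x leaves `hq`. -/
theorem one_add_sin_one_sq_le {x y : ℝ} (hxy : x ^ 2 + y ^ 2 = 1) (hx : 1 / 2 ≤ x) :
    (1 + Real.sin 1) ^ 2 ≤ 1 + 2 * (Real.sin x * Real.cosh y) + Real.sin x ^ 2
      + Real.sinh y ^ 2 := by
  have hx1 : x ≤ 1 := by nlinarith [sq_nonneg y]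
  have hpi := Real.pi_gt_three
  have hs : 479 / 1000 ≤ Real.sin x := by
    have h1 := sub_cube_le_sin (show (0 : ℝ) < 1 / 2 by norm_num)
    have h2 := Real.sin_le_sin_of_le_of_le_pi_div_two (by linarith) (by linarith) hx
    norm_num at h1; norm_num at h2; linarith
  have hD : Real.sin 1 - Real.sin x ≤ (1 - x) * (37 / 50) := by
    rw [Real.sin_sub_sin]
    have h1 : Real.sin ((1 - x) / 2) ≤ (1 - x) / 2 := Real.sin_le (by linarith)
    have h2 : Real.cos ((1 + x) / 2) ≤ 37 / 50 := by
      have h3 : Real.cos ((1 + x) / 2) ≤ Real.cos (3 / 4) :=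
        Real.cos_le_cos_of_nonneg_of_le_pi (by norm_num) (by linarith) (by linarith)
      have h4 := (abs_le.1 (Real.cos_bound (x := 3 / 4) (by norm_num [abs_of_pos]))).2
      norm_num [abs_of_pos] at h4
      linarith
    have h0 : 0 ≤ Real.cos ((1 + x) / 2) :=
      Real.cos_nonneg_of_mem_Icc ⟨by linarith, by linarith⟩
    calc 2 * Real.sin ((1 - x) / 2) * Real.cos ((1 + x) / 2)
        ≤ 2 * ((1 - x) / 2) * (37 / 50) := by gcongr
      _ = _ := by ring
  have hC : 1 + y ^ 2 / 2 ≤ Real.cosh y := by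
    linarith [one_add_sq_div_two_add_le_cosh y, show 0 ≤ y ^ 4 by positivity]
  have hS := sq_add_le_sinh_sq y
  have hs1 := sin_one_le
  have hs0 := sub_cube_le_sin one_pos
  have hsC : Real.sin x * (1 + y ^ 2 / 2) ≤ Real.sin x * Real.cosh y := by gcongr
  have hy2 : y ^ 2 = (1 - x) * (1 + x) := by linarith
  have hy4 : y ^ 4 = (1 - x) ^ 2 * (1 + x) ^ 2 := by rw [← mul_pow, ← hy2]; ring
  generalize Real.sin x = s at *
  generalize Real.sin 1 = s₁ at *
  have hq : 37 / 50 * (2 + s + s₁) ≤ (1 + x) * (1 + s) + (1 - x) * (1 + x) ^ 2 / 3 := by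
    have e1 : (1 - x) * (9 / 4) ≤ (1 - x) * (1 + x) ^ 2 := by
      gcongr
      nlinarith
    nlinarith
  have e1 : (s₁ - s) * (2 + s + s₁) ≤ (1 - x) * (37 / 50) * (2 + s + s₁) := by gcongr
  have e2 : (1 - x) * (37 / 50 * (2 + s + s₁))
      ≤ (1 - x) * ((1 + x) * (1 + s) + (1 - x) * (1 + x) ^ 2 / 3) := by
    gcongr
  rw [hy2] at hsC hS
  rw [hy4] at hS
  linarith

/-- On the right part of the unit circle, the real part of `sin` is at least `13/20`. -/
theorem le_sin_mul_cosh {x y : ℝ} (hxy : x ^ 2 + y ^ 2 = 1) (hx : 1 / 2 ≤ x) :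
    13 / 20 ≤ Real.sin x * Real.cosh y := by
  have hx1 : x ≤ 1 := by nlinarith [sq_nonneg y]
  have h1 := sub_cube_le_sin (show 0 < x by linarith)
  have hC : (3 - x ^ 2) / 2 ≤ Real.cosh y := by
    linarith [one_add_sq_div_two_add_le_cosh y, show 0 ≤ y ^ 4 by positivity]
  have hx2 : x ^ 2 ≤ 1 := by nlinarith
  have h2 : 0 ≤ x - x ^ 3 / 6 := by nlinarith
  have h3 : (x - x ^ 3 / 6) * ((3 - x ^ 2) / 2) ≤ Real.sin x * Real.cosh y :=
    mul_le_mul h1 hC (by linarith) (h2.trans h1)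
  have h4 : 0 ≤ (x - 1 / 2) * (63 / 4 - 9 / 2 * x - 9 * x ^ 2) :=
    mul_nonneg (by linarith) (by linarith)
  have h5 : 0 ≤ x ^ 5 := by positivity
  nlinarith

/-- The Taylor bounds add up to 1 + (y⁴ - x⁴)/3 = 4/3 - (2/3)x² ≥ 7/6. -/
theorem sin_sq_add_sinh_sq_gt {x y : ℝ} (hxy : x ^ 2 + y ^ 2 = 1) (hx : |x| ≤ 1 / 2) :
    (5 / 4 * Real.sin 1) ^ 2 < Real.sin x ^ 2 + Real.sinh y ^ 2 := by
  have h1 := sq_sub_le_sin_sq (hx.trans (by norm_num))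
  have h2 := sq_add_le_sinh_sq y
  have h3 : x ^ 2 ≤ (1 / 2) ^ 2 := sq_le_sq' (abs_le.1 hx).1 (abs_le.1 hx).2
  have hy4 : y ^ 4 = (1 - x ^ 2) ^ 2 := by
    rw [show 1 - x ^ 2 = y ^ 2 by linarith]; ring
  have h4 := sin_one_le
  have h5 := sub_cube_le_sin one_pos
  have h6 : Real.sin 1 ^ 2 ≤ (253 / 300) ^ 2 := pow_le_pow_left₀ (by linarith) h4 2
  linarith

theorem phiS_mk (x y : ℝ) : phiS ⟨x, y⟩ = ((1 + Real.sin x * Real.cosh y : ℝ) : ℂ) +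
    ((Real.cos x * Real.sinh y : ℝ) : ℂ) * Complex.I := by
  rw [phiS, Complex.sin_eq]
  push_cast
  ring

theorem phiS_re (x y : ℝ) : (phiS ⟨x, y⟩).re = 1 + Real.sin x * Real.cosh y := by
  rw [phiS_mk, Complex.add_re, Complex.ofReal_re, Complex.re_ofReal_mul, Complex.I_re, mul_zero,
    add_zero]

theorem phiS_im (x y : ℝ) : (phiS ⟨x, y⟩).im = Real.cos x * Real.sinh y := by
  rw [phiS_mk, Complex.add_im, Complex.ofReal_im, Complex.im_ofReal_mul, Complex.I_im, mul_one,
    zero_add]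

/-- Three arcs, three violated bounds: |a - 1| for |x| ≤ 1/2, |a| < E for x > 1/2, and the lower
bound on Re a for x < -1/2, where Re φ_S ≤ 7/20. -/
theorem not_nephroidExpBounds_phiS {ζ : ℂ} (hζ : ‖ζ‖ = 1) :
    ¬ NephroidExpBounds (1 + Real.sin 1) (phiS ζ) := by
  rintro ⟨h1, -, h3, h4⟩
  have hxy := norm_sq_eq_one hζ
  obtain ⟨x, y⟩ := ζ
  simp only at hxy
  have hs1 := sin_one_le
  have hs0 := sub_cube_le_sin one_pos
  have hn1 := Complex.sq_norm (phiS ⟨x, y⟩)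
  rw [Complex.normSq_apply, phiS_re, phiS_im] at hn1
  have hn2 := Complex.sq_norm (phiS ⟨x, y⟩ - 1)
  rw [Complex.normSq_apply, Complex.sub_re, Complex.sub_im, phiS_re, phiS_im, Complex.one_re,
    Complex.one_im] at hn2
  have hcs := Real.sin_sq_add_cos_sq x
  have hch := Real.cosh_sq y
  rcases le_or_gt |x| (1 / 2) with hx | hx
  · have h5 := sin_sq_add_sinh_sq_gt hxy hx
    have h6 := pow_le_pow_left₀ (norm_nonneg _) h3 2
    have h7 : ‖phiS ⟨x, y⟩ - 1‖ ^ 2 = Real.sin x ^ 2 + Real.sinh y ^ 2 := by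
      rw [hn2]; linear_combination Real.sin x ^ 2 * hch + Real.sinh y ^ 2 * hcs
    rw [h7, add_sub_cancel_left] at h6
    linarith
  · rcases lt_abs.1 hx with hx | hx
    · have h5 := one_add_sin_one_sq_le hxy hx.le
      have h6 := pow_lt_pow_left₀ h1 (norm_nonneg _) two_ne_zero
      have h7 : ‖phiS ⟨x, y⟩‖ ^ 2 = 1 + 2 * (Real.sin x * Real.cosh y) + Real.sin x ^ 2
          + Real.sinh y ^ 2 := by
        rw [hn1]; linear_combination Real.sin x ^ 2 * hch + Real.sinh y ^ 2 * hcs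
      linarith
    · have h5 := le_sin_mul_cosh (x := -x) (y := y) (by linarith) hx.le
      rw [Real.sin_neg] at h5
      rw [phiS_re] at h4
      have hlog := log_one_add_sin_one_le
      have hlog0 : 0 < Real.log (1 + Real.sin 1) := Real.log_pos (by linarith)
      have hlog2 := pow_le_pow_left₀ hlog0.le hlog 2
      have hinv : (553 / 300 : ℝ)⁻¹ ≤ (1 + Real.sin 1)⁻¹ :=
        inv_anti₀ (by linarith) (by linarith)
      have h6 : (553 / 300 : ℝ)⁻¹ * (69 / 100)
          ≤ (1 + Real.sin 1)⁻¹ * (1 - 25 / 32 * Real.log (1 + Real.sin 1) ^ 2) :=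
        mul_le_mul hinv (by linarith) (by norm_num) (inv_nonneg.2 (by linarith))
      norm_num at h6
      linarith

theorem isSharpNephroidBound_phiS :
    IsSharpNephroidBound phiS ((8 / 9 : ℝ) / Real.log (1 + Real.sin 1)) := by
  have hder : ∀ z, HasDerivAt phiS (Complex.cos z) z := fun z =>
    (Complex.hasDerivAt_sin z).const_add 1
  have hpi := Real.pi_gt_three
  have hs0 := sub_cube_le_sin one_pos
  have hlog := log_one_add_sin_one_le
  have hlog0 : 0 < Real.log (1 + Real.sin 1) := Real.log_pos (by linarith)
  have hodd : ∀ k : ℤ, (1 : ℝ) ≤ ‖(2 * k + 1 : ℂ)‖ := by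
    intro k
    have h1 : (2 * k + 1 : ℂ) = ((2 * k + 1 : ℤ) : ℂ) := by push_cast; rfl
    rw [h1, Complex.norm_intCast]
    exact_mod_cast Int.one_le_abs (show (2 * k + 1 : ℤ) ≠ 0 by omega)
  have hpin : ‖(Real.pi : ℂ)‖ = Real.pi := by
    rw [Complex.norm_real, Real.norm_of_nonneg Real.pi_pos.le]
  refine isSharpNephroidBound_of_bounds (by linarith) (by nlinarith)
    (fun z _ => (hder z).differentiableAt) ?_ ?_ (by simp [phiS])
    (fun ζ hζ => not_nephroidExpBounds_phiS hζ) (Or.inl ?_)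
  · intro a ha b hb hab
    rw [unitDisk, mem_ball_zero_iff] at ha hb
    -- Both |b - a| and |b + a| are below 2 < π, which leaves only k = 0 in the first case and
    -- nothing in the second.
    obtain ⟨k, h | h⟩ := Complex.sin_eq_sin_iff.1 (add_left_cancel hab : Complex.sin a = _)
    · have h1 := congrArg norm (show b - a = 2 * (k : ℂ) * Real.pi by rw [h]; ring)
      rw [norm_mul, norm_mul, hpin, Complex.norm_intCast] at h1
      have h2 := norm_sub_le b a
      have hk : k = 0 := by
        by_contra hk
        have h3 : (1 : ℝ) ≤ |(k : ℝ)| := by exact_mod_cast Int.one_le_abs hk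
        have h4 : 1 * Real.pi ≤ |(k : ℝ)| * Real.pi := by gcongr
        norm_num at h1
        linarith
      rw [h, hk]; simp
    · exfalso
      have h1 := congrArg norm (show b + a = (2 * k + 1 : ℂ) * Real.pi by rw [h]; ring)
      rw [norm_mul, hpin] at h1
      have h2 := norm_add_le b a
      have h4 : 1 * Real.pi ≤ ‖(2 * k + 1 : ℂ)‖ * Real.pi := by gcongr; exact hodd k
      linarith
  · intro z hz h0
    rw [unitDisk, mem_ball_zero_iff] at hz
    rw [(hder z).deriv] at h0
    obtain ⟨k, h⟩ := Complex.cos_eq_zero_iff.1 h0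
    have h1 := congrArg norm h
    rw [norm_div, norm_mul, hpin] at h1
    have h4 : 1 * Real.pi ≤ ‖(2 * k + 1 : ℂ)‖ * Real.pi := by gcongr; exact hodd k
    norm_num at h1
    linarith
  · rintro t ht ⟨⟨x, y⟩, hz, hzt⟩
    rw [unitDisk, mem_ball_zero_iff] at hz
    have hxy : x ^ 2 + y ^ 2 < 1 := by
      have := Complex.sq_norm (⟨x, y⟩ : ℂ)
      rw [Complex.normSq_mk] at this
      nlinarith [norm_nonneg (⟨x, y⟩ : ℂ)]
    have hx1 : x < 1 := by nlinarith [sq_nonneg y]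
    have hx2 : -1 < x := by nlinarith [sq_nonneg y]
    have hre := congrArg Complex.re hzt
    have him := congrArg Complex.im hzt
    rw [phiS_re, Complex.ofReal_re] at hre
    rw [phiS_im, Complex.ofReal_im] at him
    have hcos : 0 < Real.cos x := Real.cos_pos_of_mem_Ioo ⟨by linarith, by linarith⟩
    have hy : y = 0 := Real.sinh_eq_zero.1 ((mul_eq_zero.1 him).resolve_left hcos.ne')
    rw [hy, Real.cosh_zero, mul_one] at hre
    have := Real.sin_lt_sin_of_lt_of_le_pi_div_two (by linarith) (by linarith) hx1
    linarith

theorem mainTheorem6 :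
    IsSharpNephroidBound phiS ((8 / 9 : ℝ) / Real.log (1 + Real.sin 1)) ∧
    IsSharpNephroidBound phi0 (-((8 / 9 : ℝ) / Real.log (2 * Real.sqrt 2 - 2))) ∧
    IsSharpNephroidBound phiNe ((8 / 9 : ℝ) / Real.log (5 / 3)) :=
  ⟨isSharpNephroidBound_phiS, isSharpNephroidBound_phi0, isSharpNephroidBound_phiNe⟩
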